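/- Fix an integer $a\ge 1$ and consider the $X+Y\to 2X$ front propagation process on $\mathbb Z$. Initially there are $\eta(x)\in\{0,1,2,\dots\}$ particles of type $X$ at each site $x\le 0$ and $a$ particles of type $Y$ at each site $x\ge 1$. The $X$ particles move as independent continuous-time simple symmetric random walks of total jump rate $2$; the $Y$ particles do not move. When a site $x\ge 1$ is visited by an $X$ particle for the first time, the $a$ particles of type $Y$ at $x$ instantaneously become $X$ particles and start moving. The front $r_t\in\{0,1,2,\dots\}\cup\{\infty\}$ is the rightmost site reached up to time $t$, with $r_0:=0$ (the value $\infty$ can occur only if $\eta$ grows so fast that infinitely many sites are reached in finite time). Let $v=v(a)\in(0,\infty)$ be the velocity of the front, i.e. the deterministic number, depending only on $a$, such that $r_t/t\to v$ almost surely for the initial condition with $a$ particles at every site $x\le 0$ (and for every nonzero initial condition $\eta$ with $\sum_{x\le 0}e^{\theta x}\eta(x)<\infty$ for all $\theta>0$). Then the following hold. (i) Let $\eta$ be an initial condition for which there is a $\theta>0$ such that $\liminf_{x\to-\infty}\eta(x)e^{\theta x}=+\infty$. Then there exists $b>0$ such that $$\limsup_{t\to+\infty}\frac1t\log P\left[\frac{r_t}{t}\le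 b\right]<0$$ (with $\log 0=-\infty$). (ii) There exist $\theta'>0$ and $v'>v$, depending only on $a$, such that for every initial condition $\eta$ with $\liminf_{x\to-\infty}\eta(x)e^{\theta' x}=+\infty$, $$P\left[\liminf_{t\to+\infty}\frac{r_t}{t}\ge v'\right]=1.$$ -/

import Mathlib

open MeasureTheory ProbabilityTheory Filter Topology
open scoped NNReal ENNReal

namespace FrontPropagation

/-- Particles are labelled by their birthplace `x : ℤ` and a number `i : ℕ` distinguishing the
particles born at the same site. -/
abbrev Label : Type := ℤ × ℕ

/-- The randomness: for every label `p` and every `k : ℕ`, the holding time before jump number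
`k + 1` of the walk attached to `p`, and the increment of that jump. -/
abbrev Sample : Type := Label × ℕ → ℝ × ℤ

/-- The increment of a simple symmetric random walk: uniform on `{-1, 1}`. -/
noncomputable def stepLaw : Measure ℤ := uniformOn ({-1, 1} : Set ℤ)

instance : IsProbabilityMeasure stepLaw :=
  isProbabilityMeasure_uniformOn (Set.toFinite _) (Set.insert_nonempty _ _)

instance : IsProbabilityMeasure (expMeasure 2) :=
  isProbabilityMeasure_expMeasure (by norm_num)

/-- All holding times are exponential of parameter `2`, all increments are uniform on `{-1, 1}`,
and everything is independent. -/
noncomputable def law : Measure Sample :=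
  Measure.infinitePi (fun _ : Label × ℕ => (expMeasure 2).prod stepLaw)

instance : IsProbabilityMeasure law := by
  unfold law
  infer_instance

/-- The time of the `n`-th jump of the walk attached to `p`. -/
noncomputable def jumpTime (ω : Sample) (p : Label) (n : ℕ) : ℝ :=
  ∑ k ∈ Finset.range n, (ω (p, k)).1

/-- The number of jumps made up to time `s` by the walk attached to `p`. -/
noncomputable def numJumps (ω : Sample) (p : Label) (s : ℝ) : ℕ :=
  sSup {n : ℕ | jumpTime ω p n ≤ s}

/-- The displacement at age `s` of the particle `p`: a continuous-time simple symmetric random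
walk of total jump rate `2`, started at `0`. -/
noncomputable def walk (ω : Sample) (p : Label) (s : ℝ) : ℤ :=
  ∑ k ∈ Finset.range (numJumps ω p s), (ω (p, k)).2

/-- `frontTime a η ω n` is the time at which the front, which starts at `0`, moves to site `n`.

At time `0` there are `η x` particles of type `X` at each site `x ≤ 0` (the values of `η` at
positive sites are not used) and `a` particles of type `Y` at each site `x ≥ 1`. Once the front
is at `n`, it moves to `n + 1` at the first later time at which some `X` particle sits at `n + 1`.
The `X` particles are then the initial ones, `(x, i)` with `x ≤ 0` and `i < η x`, located at time
`t` at `x + walk ω (x, i) t`, and those born at the sites `k + 1 = 1, …, n`, namely `(k + 1, i)`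
with `i < a`, which move from time `frontTime a η ω (k + 1)` on. The infimum of the empty set
is `∞`. -/
noncomputable def frontTime (a : ℕ) (η : ℤ → ℕ) (ω : Sample) : ℕ → ℝ≥0∞
  | 0 => 0
  | n + 1 =>
    ⨅ (t : ℝ≥0) (_ : frontTime a η ω n < (t : ℝ≥0∞) ∧
        ((∃ (x : ℤ) (i : ℕ), x ≤ 0 ∧ i < η x ∧ x + walk ω (x, i) (t : ℝ) = (n : ℤ) + 1) ∨
          ∃ (k : Fin n) (i : ℕ), i < a ∧
            ((k : ℕ) + 1 : ℤ) + walk ω (((k : ℕ) + 1 : ℤ), i)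
              ((t : ℝ) - (frontTime a η ω ((k : ℕ) + 1)).toReal) = (n : ℤ) + 1)),
      (t : ℝ≥0∞)
termination_by n => n
decreasing_by
  all_goals omega

/-- The front `r_t`: the rightmost site reached up to time `t`, starting from `r_0 = 0`.
The value `∞` is allowed: it occurs when the initial condition grows so fast that infinitely
many sites are reached in finite time. -/
noncomputable def front (a : ℕ) (η : ℤ → ℕ) (ω : Sample) (t : ℝ≥0) : ℕ∞ :=
  ⨆ (n : ℕ) (_ : frontTime a η ω n ≤ (t : ℝ≥0∞)), (n : ℕ∞)

/-- The ratio `r_t / t`. -/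
noncomputable def frontRatio (a : ℕ) (η : ℤ → ℕ) (ω : Sample) (t : ℝ≥0) : ℝ≥0∞ :=
  (front a η ω t : ℝ≥0∞) / (t : ℝ≥0∞)

/-- The velocity `v` of the front, read off from the initial condition with `a` particles of
type `X` at each site `x ≤ 0`: the smallest constant which almost surely bounds
`limsup r_t / t`. It is the almost sure limit of `r_t / t` whenever that limit exists and is
deterministic, see `velocity_eq_of_tendsto`. -/
noncomputable def velocity (a : ℕ) : ℝ≥0∞ :=
  essSup (fun ω => limsup (fun t : ℝ≥0 => frontRatio a (fun _ => a) ω t) atTop) law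

theorem velocity_eq_of_tendsto (a : ℕ) (v : ℝ≥0∞)
    (h : ∀ᵐ ω ∂law, Tendsto (fun t : ℝ≥0 => frontRatio a (fun _ => a) ω t) atTop (𝓝 v)) :
    velocity a = v := by
  have h' : (fun ω => limsup (fun t : ℝ≥0 => frontRatio a (fun _ => a) ω t) atTop)
      =ᵐ[law] fun _ => v := by
    filter_upwards [h] with ω hω using hω.limsup_eq
  rw [velocity, essSup_congr_ae h', essSup_const _ (IsProbabilityMeasure.ne_zero law)]

end FrontPropagation

open FrontPropagation

/-! Both parts use only remote initial particles. The front is beyond `D` at time `t` as soon as one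
particle started at `-m` has reached `D`. The walks are independent, so if one of them succeeds with
probability at least `p`, all fail with probability at most `(1 - p) ^ N ≤ exp (-N p)`, where `N = η
(-m)` is at least `exp (θ m)` for large `m` (`law_lt_frontTime_le`). It remains to choose `m` and
`D` linear in `t` so that `N p` is large.

For (i), `θ` may be small. Displacing a walk by order `lam * n` in `n` short jumps costs only `exp
(-2 lam² n)` (`exp_le_measureReal_escapeSet`, a second moment argument), whereas the number of
available particles is exponential in `θ lam n`. A quadratic cost loses against a linear gain once
`lam` is small compared with `θ`, which gives a positive speed with failure probability at most `exp
(-t)`.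

For (ii), any speed `V` is attained if `θ` is large: forcing all jumps to be fast and upwards has an
exponential cost that depends only on `V` (`pow_le_measureReal_escapeSet`), and Borel-Cantelli over
integer times concludes. To choose `V` above the velocity, the velocity must be finite
(`velocity_lt_top`). Any arrival at `n` is produced by a chain of activated particles, each making
at least as many jumps as the distance it covers. The expected exponential weight of all such chains
decays geometrically in `n` when the Laplace parameter is large, so the front is at most ballistic.
-/

namespace FrontPropagation

/-! ### Almost sure properties of the sample -/

/-- All holding times are positive and all increments are `-1` or `1`. -/
def Regular (ω : Sample) : Prop :=
  ∀ q, 0 < (ω q).1 ∧ ((ω q).2 = -1 ∨ (ω q).2 = 1)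

theorem measureReal_Iic_expMeasure {h : ℝ} (hh : 0 ≤ h) :
    (expMeasure 2).real (Set.Iic h) = 1 - Real.exp (-(2 * h)) := by
  rw [← cdf_eq_real, cdf_expMeasure_eq (by norm_num), if_pos hh]

theorem ae_pos_expMeasure : ∀ᵐ x ∂expMeasure 2, 0 < x := by
  have h : (expMeasure 2).real (Set.Iic 0) = 0 := by
    rw [measureReal_Iic_expMeasure le_rfl]; simp
  rw [measureReal_eq_zero_iff] at h
  rw [ae_iff]
  simpa [Set.Iic] using h

theorem ae_stepLaw : ∀ᵐ s ∂stepLaw, s = -1 ∨ s = 1 := by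
  rw [ae_iff, stepLaw, uniformOn_eq_zero_iff (Set.toFinite _)]
  ext s
  simp only [Set.mem_inter_iff, Set.mem_insert_iff, Set.mem_singleton_iff, Set.mem_ofPred_eq]
  tauto

theorem stepLaw_singleton {s : ℤ} (hs : s = -1 ∨ s = 1) : stepLaw {s} = 2⁻¹ := by
  have h := uniformOn_apply_finset (s := ({-1, 1} : Finset ℤ)) (t := {s})
  have hc : (({-1, 1} : Finset ℤ) ∩ {s}).card = 1 := by
    rcases hs with rfl | rfl <;> decide
  rw [hc] at h
  simp only [Finset.coe_insert, Finset.coe_singleton] at h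
  rw [stepLaw, h]
  norm_num

theorem ae_regular : ∀ᵐ ω ∂law, Regular ω := by
  unfold Regular
  rw [ae_all_iff]
  intro q
  have hq : ∀ᵐ z ∂(expMeasure 2).prod stepLaw, 0 < z.1 ∧ (z.2 = -1 ∨ z.2 = 1) := by
    have h1 := (Measure.quasiMeasurePreserving_fst (μ := expMeasure 2) (ν := stepLaw)).ae
      ae_pos_expMeasure
    have h2 := (Measure.quasiMeasurePreserving_snd (μ := expMeasure 2) (ν := stepLaw)).ae
      ae_stepLaw
    filter_upwards [h1, h2] with z hz1 hz2 using ⟨hz1, hz2⟩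
  exact (measurePreserving_eval_infinitePi
    (fun _ : Label × ℕ => (expMeasure 2).prod stepLaw) q).quasiMeasurePreserving.ae hq

theorem stepLaw_eq : stepLaw = (2⁻¹ : ℝ≥0∞) • (Measure.dirac (-1 : ℤ) + Measure.dirac 1) := by
  refine Measure.ext_of_singleton fun s => ?_
  by_cases hs : s = -1 ∨ s = 1
  · rw [stepLaw_singleton hs]
    rcases hs with rfl | rfl <;> simp
  · have h0 : stepLaw {s} = 0 := by
      rw [stepLaw, uniformOn_eq_zero_iff (Set.toFinite _)]
      ext u
      simp only [Set.mem_inter_iff, Set.mem_insert_iff, Set.mem_singleton_iff,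
        Set.mem_empty_iff_false, iff_false]
      rintro ⟨h1, rfl⟩
      exact hs h1
    push Not at hs
    rw [h0]
    simp [hs.1.symm, hs.2.symm]

theorem lintegral_exp_mul_stepLaw (lam : ℝ) :
    ∫⁻ s, ENNReal.ofReal (Real.exp (lam * s)) ∂stepLaw = ENNReal.ofReal (Real.cosh lam) := by
  rw [stepLaw_eq, lintegral_smul_measure, lintegral_add_measure, lintegral_dirac, lintegral_dirac,
    ← ENNReal.ofReal_add (Real.exp_pos _).le (Real.exp_pos _).le, smul_eq_mul, Real.cosh_eq,
    ENNReal.ofReal_div_of_pos two_pos, ENNReal.ofReal_ofNat, mul_comm, ENNReal.div_eq_inv_mul,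
    mul_comm]
  congr 2
  push_cast
  ring_nf

/-! ### Pathwise bounds for the front -/

section Pathwise

variable {ω : Sample} {a : ℕ} {η : ℤ → ℕ}

theorem Regular.strictMono_jumpTime (hω : Regular ω) (p : Label) : StrictMono (jumpTime ω p) :=
  strictMono_nat_of_lt_succ fun n => by
    unfold jumpTime
    rw [Finset.sum_range_succ]
    linarith [(hω (p, n)).1]

theorem Regular.jumpTime_nonneg (hω : Regular ω) (p : Label) (n : ℕ) : 0 ≤ jumpTime ω p n :=
  Finset.sum_nonneg fun k _ => (hω (p, k)).1.le

theorem Regular.walk_jumpTime (hω : Regular ω) (p : Label) (n : ℕ) :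
    walk ω p (jumpTime ω p n) = ∑ k ∈ Finset.range n, (ω (p, k)).2 := by
  have h : numJumps ω p (jumpTime ω p n) = n := by
    have hs : {k : ℕ | jumpTime ω p k ≤ jumpTime ω p n} = Set.Iic n := by
      ext k
      exact (hω.strictMono_jumpTime p).le_iff_le
    rw [numJumps, hs, csSup_Iic]
  rw [walk, h]

/-- A walk needs at least `d` jumps in order to reach `d`. -/
theorem Regular.jumpTime_le_of_le_walk (hω : Regular ω) (p : Label) {s : ℝ} {d : ℕ} (hd : 0 < d)
    (h : (d : ℤ) ≤ walk ω p s) : jumpTime ω p d ≤ s := by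
  have h1 : walk ω p s ≤ numJumps ω p s := by
    unfold walk
    refine (Finset.sum_le_card_nsmul _ _ 1 fun k _ => ?_).trans (by simp)
    rcases (hω (p, k)).2 with h | h <;> omega
  have h2 : d ≤ numJumps ω p s := by exact_mod_cast h.trans h1
  have h3 : jumpTime ω p (numJumps ω p s) ≤ s := by
    -- `sSup` on `ℕ` is `0` for empty and for unbounded sets; a nonzero value excludes both, so the
    -- supremum is attained.
    have hb : numJumps ω p s ≠ 0 := by omega
    refine Nat.sSup_mem (s := {n : ℕ | jumpTime ω p n ≤ s}) ?_ ?_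
    · by_contra he
      rw [Set.not_nonempty_iff_eq_empty] at he
      exact hb (by rw [numJumps, he]; simp)
    · by_contra he
      exact hb (by rw [numJumps, Nat.sSup_of_not_bddAbove he])
  exact ((hω.strictMono_jumpTime p).monotone h2).trans h3

theorem frontTime_le_succ (a : ℕ) (η : ℤ → ℕ) (ω : Sample) (n : ℕ) :
    frontTime a η ω n ≤ frontTime a η ω (n + 1) := by
  conv_rhs => rw [frontTime]
  exact le_iInf₂ fun t ht => ht.1.le

theorem monotone_frontTime (a : ℕ) (η : ℤ → ℕ) (ω : Sample) : Monotone (frontTime a η ω) :=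
  monotone_nat_of_le_succ (frontTime_le_succ a η ω)

/-- Sites reached by an initial particle are reached by the front. -/
theorem Regular.frontTime_le_jumpTime (hω : Regular ω) {x : ℤ} (hx : x ≤ 0) {i : ℕ}
    (hi : i < η x) (D : ℕ) (n : ℕ) (h : (D : ℤ) ≤ x + ∑ k ∈ Finset.range n, (ω ((x, i), k)).2) :
    frontTime a η ω D ≤ ENNReal.ofReal (jumpTime ω (x, i) n) := by
  induction D generalizing n with
  | zero => rw [frontTime]; exact zero_le
  | succ D ih =>
    induction n with
    | zero => simp at h; omega
    | succ n ihn =>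
      -- Either the level was passed earlier, or this unit jump goes exactly from `D` to `D + 1`. In
      -- the latter case the front was at `D` by the previous jump, hence strictly earlier, as
      -- `frontTime` requires.
      by_cases hn : ((D + 1 : ℕ) : ℤ) ≤ x + ∑ k ∈ Finset.range n, (ω ((x, i), k)).2
      · exact (ihn hn).trans (ENNReal.ofReal_le_ofReal
          ((hω.strictMono_jumpTime _).monotone n.le_succ))
      · have hs := (hω ((x, i), n)).2
        rw [Finset.sum_range_succ] at h
        have h0 := hω.jumpTime_nonneg (x, i) (n + 1)
        have hlt : frontTime a η ω D < ENNReal.ofReal (jumpTime ω (x, i) (n + 1)) := by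
          refine (ih n (by push_cast at h; omega)).trans_lt ?_
          exact (ENNReal.ofReal_lt_ofReal_iff_of_nonneg (hω.jumpTime_nonneg _ _)).2
            (hω.strictMono_jumpTime _ n.lt_succ_self)
        rw [frontTime]
        refine iInf₂_le_of_le (jumpTime ω (x, i) (n + 1)).toNNReal ⟨hlt, Or.inl
          ⟨x, i, hx, hi, ?_⟩⟩ le_rfl
        rw [Real.coe_toNNReal _ h0, hω.walk_jumpTime, Finset.sum_range_succ]
        push_cast at h hn
        omega

theorem le_front {n : ℕ} {t : ℝ≥0} (h : frontTime a η ω n ≤ t) : (n : ℕ∞) ≤ front a η ω t :=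
  le_iSup₂_of_le n h le_rfl

/-! ### Chains of activations -/

/-- The weight `∏ exp (-lam * holding time)` of the first `n` jumps of the walk of `p`. -/
noncomputable def pathWeight (lam : ℝ) (ω : Sample) (p : Label) (n : ℕ) : ℝ≥0∞ :=
  ∏ k ∈ Finset.range n, ENNReal.ofReal (Real.exp (-lam * (ω (p, k)).1))

theorem pathWeight_eq (lam : ℝ) (ω : Sample) (p : Label) (n : ℕ) :
    pathWeight lam ω p n = ENNReal.ofReal (Real.exp (-lam * jumpTime ω p n)) := by
  rw [pathWeight, ← ENNReal.ofReal_prod_of_nonneg fun k _ => (Real.exp_pos _).le, ← Real.exp_sum,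
    jumpTime, Finset.mul_sum]

/-- The total weight of the chains of activations that can bring the front to `n`. -/
noncomputable def chainWeight (lam : ℝ) (a : ℕ) (ω : Sample) : ℕ → ℝ≥0∞
  | 0 => 1
  | n + 1 =>
    (∑' j : ℕ, ∑ i ∈ Finset.range a, pathWeight lam ω (-(j : ℤ), i) (n + 1 + j)) +
      ∑ k : Fin n, chainWeight lam a ω ((k : ℕ) + 1) *
        ∑ i ∈ Finset.range a, pathWeight lam ω (((k : ℕ) + 1 : ℤ), i) (n - k)
termination_by n => n
decreasing_by
  all_goals omega

/-- Trace the arrival back to the particle that caused it: it is an initial one, or it was born at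
an earlier site whose activation time is handled by induction. Its jump times bound its travel time
from below, and the exponential turns the sum of the times into a product of weights, one of the
terms of `chainWeight`. -/
theorem Regular.exp_le_chainWeight (hω : Regular ω) {lam : ℝ} (hlam : 0 ≤ lam) (n : ℕ) {t : ℝ}
    (ht : 0 ≤ t) (h : frontTime a (fun _ => a) ω n ≤ ENNReal.ofReal t) :
    ENNReal.ofReal (Real.exp (-lam * t)) ≤ chainWeight lam a ω n := by
  induction n using Nat.strong_induction_on generalizing t with
  | _ n ih =>
  cases n with
  | zero =>
    rw [chainWeight]
    refine ENNReal.ofReal_le_one.2 (Real.exp_le_one_iff.2 ?_)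
    nlinarith
  | succ n =>
    -- The infimum defining `frontTime` need not be attained, so the argument is run for `t' > t`
    -- and `t'` then decreases to `t`.
    have key : ∀ t' : ℝ, t < t' →
        ENNReal.ofReal (Real.exp (-lam * t')) ≤ chainWeight lam a ω (n + 1) := by
      intro t' htt'
      have h' := h.trans_lt ((ENNReal.ofReal_lt_ofReal_iff_of_nonneg ht).2 htt')
      rw [frontTime] at h'
      simp only [iInf_lt_iff] at h'
      obtain ⟨s, ⟨hs1, hs2⟩, hs3⟩ := h'
      have hst : (s : ℝ) ≤ t' := by
        rw [← ENNReal.ofReal_coe_nnreal] at hs3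
        exact ((ENNReal.ofReal_lt_ofReal_iff_of_nonneg s.2).1 hs3).le
      have hmono : ∀ {u v : ℝ}, u ≤ v →
          ENNReal.ofReal (Real.exp (-lam * v)) ≤ ENNReal.ofReal (Real.exp (-lam * u)) := by
        intro u v huv
        apply ENNReal.ofReal_le_ofReal
        apply Real.exp_le_exp.2
        nlinarith
      refine (hmono hst).trans ?_
      rw [chainWeight]
      rcases hs2 with ⟨x, i, hx, hi, hw⟩ | ⟨k, i, hi, hw⟩
      · refine le_trans ?_ le_self_add
        obtain ⟨j, rfl⟩ : ∃ j : ℕ, x = -(j : ℤ) := ⟨(-x).toNat, by omega⟩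
        refine le_trans ?_ (ENNReal.le_tsum j)
        refine le_trans ?_ (Finset.single_le_sum (fun _ _ => zero_le) (Finset.mem_range.2 hi))
        rw [pathWeight_eq]
        refine hmono (hω.jumpTime_le_of_le_walk _ (by omega) ?_)
        push_cast
        omega
      · refine le_trans ?_ le_add_self
        refine le_trans ?_ (Finset.single_le_sum (fun _ _ => zero_le) (Finset.mem_univ k))
        have hkn : frontTime a (fun _ => a) ω (k + 1) < s :=
          (monotone_frontTime _ _ _ (by omega)).trans_lt hs1
        set τ := frontTime a (fun _ => a) ω ((k : ℕ) + 1) with hτ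
        have hτtop : τ ≠ ⊤ := hkn.ne_top
        have h1 := ih (k + 1) (by omega) (t := τ.toReal) ENNReal.toReal_nonneg
          (by rw [ENNReal.ofReal_toReal hτtop])
        have h2 := hω.jumpTime_le_of_le_walk (((k : ℕ) + 1 : ℤ), i) (s := s - τ.toReal)
          (d := n - k) (by omega) (by omega)
        have h3 : ENNReal.ofReal (Real.exp (-lam * s)) ≤
            ENNReal.ofReal (Real.exp (-lam * τ.toReal)) *
              pathWeight lam ω (((k : ℕ) + 1 : ℤ), i) (n - k) := by
          rw [pathWeight_eq, ← ENNReal.ofReal_mul (Real.exp_pos _).le, ← Real.exp_add, ← mul_add]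
          exact hmono (by linarith)
        refine h3.trans (mul_le_mul' h1 ?_)
        exact Finset.single_le_sum (f := fun i => pathWeight lam ω (((k : ℕ) + 1 : ℤ), i) (n - k))
          (fun _ _ => zero_le) (Finset.mem_range.2 hi)
    have hc : Tendsto (fun t' : ℝ => ENNReal.ofReal (Real.exp (-lam * t'))) (𝓝[>] t)
        (𝓝 (ENNReal.ofReal (Real.exp (-lam * t)))) := by
      have : Continuous fun t' : ℝ => ENNReal.ofReal (Real.exp (-lam * t')) :=
        ENNReal.continuous_ofReal.comp (by fun_prop)
      exact this.continuousAt.tendsto.mono_left nhdsWithin_le_nhds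
    exact le_of_tendsto hc (by filter_upwards [self_mem_nhdsWithin] with t' ht' using key t' ht')

end Pathwise

/-! ### Finiteness of the velocity -/

/-- The Laplace transform at `lam` of a holding time. -/
noncomputable def holdingLaplace (lam : ℝ) : ℝ≥0∞ :=
  ∫⁻ z, ENNReal.ofReal (Real.exp (-lam * z.1)) ∂(expMeasure 2).prod stepLaw

theorem measurable_ofReal_exp_mul_fst (lam : ℝ) :
    Measurable fun z : ℝ × ℤ => ENNReal.ofReal (Real.exp (-lam * z.1)) := by
  fun_prop

/-- Dominated convergence, since holding times are almost surely positive. This smallness is what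
beats the branching factor of the chains. -/
theorem tendsto_holdingLaplace :
    Tendsto (fun n : ℕ => holdingLaplace n) atTop (𝓝 0) := by
  have hpos : ∀ᵐ z ∂(expMeasure 2).prod stepLaw, 0 < z.1 :=
    (Measure.quasiMeasurePreserving_fst (μ := expMeasure 2) (ν := stepLaw)).ae ae_pos_expMeasure
  have h := tendsto_lintegral_of_dominated_convergence (μ := (expMeasure 2).prod stepLaw)
    (F := fun (n : ℕ) z => ENNReal.ofReal (Real.exp (-(n : ℝ) * z.1))) (f := fun _ => 0)
    (fun _ => 1) (fun n => measurable_ofReal_exp_mul_fst n) ?_ (by simp) ?_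
  · simpa [holdingLaplace] using h
  · intro n
    filter_upwards [hpos] with z hz
    refine ENNReal.ofReal_le_one.2 (Real.exp_le_one_iff.2 ?_)
    have : (0 : ℝ) ≤ n := n.cast_nonneg
    nlinarith
  · filter_upwards [hpos] with z hz
    rw [← ENNReal.ofReal_zero]
    refine ENNReal.tendsto_ofReal (Real.tendsto_exp_atBot.comp ?_)
    have : Tendsto (fun n : ℕ => (n : ℝ) * z.1) atTop atTop :=
      tendsto_natCast_atTop_atTop.atTop_mul_const hz
    simpa only [neg_mul] using! tendsto_neg_atTop_atBot.comp this

theorem lintegral_pathWeight (lam : ℝ) (p : Label) (n : ℕ) :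
    ∫⁻ ω, pathWeight lam ω p n ∂law = holdingLaplace lam ^ n := by
  have hind : iIndepFun (fun (k : ℕ) (ω : Sample) =>
      ENNReal.ofReal (Real.exp (-lam * (ω (p, k)).1))) law :=
    (iIndepFun_infinitePi (P := fun _ : Label × ℕ => (expMeasure 2).prod stepLaw)
      (X := fun _ z => ENNReal.ofReal (Real.exp (-lam * z.1)))
      (fun _ => measurable_ofReal_exp_mul_fst lam)).precomp (g := fun k : ℕ => (p, k))
      (fun k l h => (Prod.ext_iff.1 h).2)
  unfold pathWeight
  rw [lintegral_prod_eq_prod_lintegral_of_indepFun _ _ hind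
    fun k => (measurable_ofReal_exp_mul_fst lam).comp (measurable_pi_apply (p, k))]
  rw [Finset.prod_congr rfl (g := fun _ => holdingLaplace lam), Finset.prod_const,
    Finset.card_range]
  intro k _
  exact (measurePreserving_eval_infinitePi
    (fun _ : Label × ℕ => (expMeasure 2).prod stepLaw) (p, k)).lintegral_comp
    (measurable_ofReal_exp_mul_fst lam)

/-- The `σ`-algebra generated by the randomness attached to the labels in `S`. -/
@[reducible] def labelSigma (S : Set (Label × ℕ)) : MeasurableSpace Sample :=
  ⨆ q ∈ S, MeasurableSpace.comap (fun ω : Sample => ω q) inferInstance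

theorem labelSigma_mono {S T : Set (Label × ℕ)} (h : S ⊆ T) : labelSigma S ≤ labelSigma T :=
  biSup_mono fun _ hq => h hq

theorem labelSigma_le (S : Set (Label × ℕ)) : labelSigma S ≤ MeasurableSpace.pi :=
  iSup₂_le fun q _ => (measurable_pi_apply q).comap_le

theorem indep_labelSigma {S T : Set (Label × ℕ)} (h : Disjoint S T) :
    Indep (labelSigma S) (labelSigma T) law :=
  indep_iSup_of_disjoint (fun q => (measurable_pi_apply q).comap_le)
    (iIndepFun_infinitePi (P := fun _ : Label × ℕ => (expMeasure 2).prod stepLaw)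
      (X := fun _ z => z) (fun _ => measurable_id)) h

theorem measurable_pathWeight {lam : ℝ} {S : Set (Label × ℕ)} {p : Label}
    (hS : ∀ k, (p, k) ∈ S) (n : ℕ) :
    Measurable[labelSigma S] fun ω => pathWeight lam ω p n := by
  unfold pathWeight
  refine Finset.measurable_fun_prod _ fun k _ => ?_
  refine (measurable_ofReal_exp_mul_fst lam).comp ?_
  exact measurable_iff_comap_le.2 (le_iSup₂_of_le (p, k) (hS k) le_rfl)

theorem measurable_chainWeight (lam : ℝ) (a n : ℕ) :
    Measurable[labelSigma {q | q.1.1 < max n 1}] fun ω => chainWeight lam a ω n := by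
  induction n using Nat.strong_induction_on with
  | _ n ih =>
  cases n with
  | zero =>
    simp only [chainWeight]
    exact measurable_const
  | succ n =>
    conv => enter [1, ω]; rw [chainWeight]
    refine Measurable.add ?_ ?_
    · simp_rw [ENNReal.tsum_eq_iSup_sum]
      refine .iSup fun s => s.measurable_fun_sum fun j _ =>
        Finset.measurable_fun_sum _ fun i _ => ?_
      refine measurable_pathWeight (fun k => ?_) _
      change -(j : ℤ) < _
      push_cast
      omega
    · refine Finset.measurable_fun_sum _ fun k _ => Measurable.mul ?_ ?_
      · refine (ih (k + 1) (by omega)).mono (labelSigma_mono fun q hq => ?_) le_rfl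
        have hk := k.2
        change q.1.1 < _ at hq
        change q.1.1 < _
        push_cast at hq ⊢
        omega
      · refine Finset.measurable_fun_sum _ fun i _ => measurable_pathWeight (fun l => ?_) _
        have hk := k.2
        change ((k : ℕ) + 1 : ℤ) < _
        push_cast
        omega

theorem measurable_pathWeight_pi (lam : ℝ) (p : Label) (n : ℕ) :
    Measurable fun ω => pathWeight lam ω p n :=
  (measurable_pathWeight (S := Set.univ) (fun _ => trivial) n).mono (labelSigma_le _) le_rfl

theorem measurable_chainWeight_pi (lam : ℝ) (a n : ℕ) :
    Measurable fun ω => chainWeight lam a ω n :=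
  (measurable_chainWeight lam a n).mono (labelSigma_le _) le_rfl

/-- The expectation factorizes because the weight up to site `k + 1` depends only on labels born
strictly to its left, while the last leg uses labels born at `k + 1`. -/
theorem lintegral_chainWeight_succ (lam : ℝ) (a n : ℕ) :
    ∫⁻ ω, chainWeight lam a ω (n + 1) ∂law =
      ∑' j : ℕ, a * holdingLaplace lam ^ (n + 1 + j) +
        ∑ k ∈ Finset.range n, (∫⁻ ω, chainWeight lam a ω (k + 1) ∂law) *
          (a * holdingLaplace lam ^ (n - k)) := by
  have hsum : ∀ (x : ℤ) (d : ℕ), ∫⁻ ω, ∑ i ∈ Finset.range a, pathWeight lam ω (x, i) d ∂law =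
      a * holdingLaplace lam ^ d := by
    intro x d
    rw [lintegral_finsetSum _ fun i _ => measurable_pathWeight_pi _ _ _]
    simp [lintegral_pathWeight]
  have hm : ∀ (x : ℤ) (d : ℕ),
      Measurable fun ω => ∑ i ∈ Finset.range a, pathWeight lam ω (x, i) d :=
    fun x d => Finset.measurable_fun_sum _ fun i _ => measurable_pathWeight_pi _ _ _
  conv_lhs => enter [2, ω]; rw [chainWeight]
  rw [lintegral_add_left (Measurable.tsum fun j => hm _ _),
    lintegral_tsum fun j => (hm _ _).aemeasurable,
    lintegral_finsetSum _ fun (k : Fin n) _ =>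
      (measurable_chainWeight_pi lam a (k + 1)).fun_mul (hm ((k : ℕ) + 1) (n - k))]
  congr 1
  · exact tsum_congr fun j => hsum _ _
  · rw [Finset.sum_range]
    refine Finset.sum_congr rfl fun k _ => ?_
    rw [← hsum ((k : ℕ) + 1) (n - k)]
    refine lintegral_mul_eq_lintegral_mul_lintegral_of_independent_measurableSpace
      (labelSigma_le _) (labelSigma_le {q | q.1.1 = (k : ℕ) + 1}) (indep_labelSigma ?_)
      (measurable_chainWeight lam a (k + 1))
      (Finset.measurable_fun_sum _ fun i _ => measurable_pathWeight (fun _ => rfl) _)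
    rw [Set.disjoint_left]
    intro q hq hq'
    change q.1.1 < _ at hq
    change q.1.1 = _ at hq'
    push_cast at hq
    omega

theorem lintegral_chainWeight_le {lam : ℝ} (h : holdingLaplace lam ≤ 2⁻¹) (a n : ℕ) :
    ∫⁻ ω, chainWeight lam a ω (n + 1) ∂law ≤
      4 * a * ((2 * a + 1) * holdingLaplace lam) ^ (n + 1) := by
  induction n using Nat.strong_induction_on with
  | _ n ih =>
  rw [lintegral_chainWeight_succ]
  set ρ := holdingLaplace lam with hρ
  -- With `r - 1 = 2 * a` the geometric sum `∑ r ^ k * (2 * a)` telescopes below `r ^ n`, so initial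
  -- particles and later births each contribute at most half of the bound.
  set r : ℝ≥0∞ := 2 * a + 1 with hr
  have hr1 : 1 ≤ r := le_add_self
  have h1 : ∑' j : ℕ, a * ρ ^ (n + 1 + j) ≤ 2 * a * (r * ρ) ^ (n + 1) := by
    have hg : ∑' j : ℕ, ρ ^ j ≤ 2 := by
      rw [← ENNReal.tsum_geometric_two]
      exact ENNReal.tsum_le_tsum fun j => pow_le_pow_left' h j
    calc ∑' j : ℕ, a * ρ ^ (n + 1 + j) = a * ρ ^ (n + 1) * ∑' j : ℕ, ρ ^ j := by
          rw [← ENNReal.tsum_mul_left]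
          exact tsum_congr fun j => by rw [pow_add, mul_assoc]
      _ ≤ a * (r * ρ) ^ (n + 1) * 2 := by
          gcongr
          exact le_mul_of_one_le_left zero_le hr1
      _ = _ := by ring
  have h2 : ∑ k ∈ Finset.range n, (∫⁻ ω, chainWeight lam a ω (k + 1) ∂law) * (a * ρ ^ (n - k)) ≤
      2 * a * (r * ρ) ^ (n + 1) := by
    calc _ ≤ ∑ k ∈ Finset.range n, 4 * a * (r * ρ) ^ (k + 1) * (a * ρ ^ (n - k)) :=
          Finset.sum_le_sum fun k hk => mul_le_mul' (ih k (Finset.mem_range.1 hk)) le_rfl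
      _ = ∑ k ∈ Finset.range n, 2 * a * r * ρ ^ (n + 1) * (r ^ k * (2 * a)) := by
          refine Finset.sum_congr rfl fun k hk => ?_
          have : n + 1 = (k + 1) + (n - k) := by have := Finset.mem_range.1 hk; omega
          rw [this, pow_add ρ, mul_pow, pow_succ r]
          ring
      _ = 2 * a * r * ρ ^ (n + 1) * ((∑ k ∈ Finset.range n, r ^ k) * (2 * a)) := by
          rw [← Finset.mul_sum, Finset.sum_mul]
      _ ≤ 2 * a * r * ρ ^ (n + 1) * r ^ n := by
          gcongr
          rw [hr, ← geom_sum_mul_add (2 * (a : ℝ≥0∞)) n]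
          exact le_self_add
      _ = _ := by rw [mul_pow]; ring
  calc _ ≤ 2 * a * (r * ρ) ^ (n + 1) + 2 * a * (r * ρ) ^ (n + 1) := add_le_add h1 h2
    _ = _ := by ring

/-- Started from `a` particles at each site `x ≤ 0`, the front is at most ballistic. -/
theorem exists_frontTime_ge (a : ℕ) :
    ∃ c : ℝ, 0 < c ∧ ∀ᵐ ω ∂law, ∀ᶠ n : ℕ in atTop,
      ENNReal.ofReal (c * n) ≤ frontTime a (fun _ => a) ω n := by
  -- This threshold makes the geometric ratio of the expected weights at most `1/4`, so they remain
  -- summable after multiplication by `2 ^ n`.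
  have hε : (0 : ℝ≥0∞) < (4 * (2 * (a : ℝ≥0∞) + 1))⁻¹ := by
    rw [ENNReal.inv_pos]
    finiteness
  obtain ⟨m, hm, hm1⟩ := ((tendsto_holdingLaplace.eventually (Iic_mem_nhds hε)).and
    (eventually_ge_atTop 1)).exists
  change holdingLaplace m ≤ _ at hm
  have hm0 : (0 : ℝ) < m := by exact_mod_cast hm1
  have hr : (2 * (a : ℝ≥0∞) + 1) * holdingLaplace m ≤ 4⁻¹ := by
    calc _ ≤ (2 * (a : ℝ≥0∞) + 1) * (4 * (2 * (a : ℝ≥0∞) + 1))⁻¹ := by gcongr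
      _ = 4⁻¹ := by
        rw [ENNReal.mul_inv (by simp) (by simp), mul_left_comm,
          ENNReal.mul_inv_cancel (by simp) (by finiteness), mul_one]
  have hhalf : holdingLaplace m ≤ 2⁻¹ := by
    refine hm.trans (ENNReal.inv_le_inv.2 ?_)
    calc (2 : ℝ≥0∞) ≤ 4 * 1 := by norm_num
      _ ≤ _ := by gcongr; exact le_add_self
  -- Chosen so that `exp (-m * c * n) = 2 ^ (-n)`, which the weight of the chains is eventually
  -- below.
  refine ⟨Real.log 2 / m, div_pos (Real.log_pos one_lt_two) hm0, ?_⟩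
  have hfin : ∫⁻ ω, ∑' n : ℕ, 2 ^ (n + 1) * chainWeight m a ω (n + 1) ∂law ≠ ⊤ := by
    rw [lintegral_tsum fun n => ((measurable_chainWeight_pi _ _ _).const_mul _).aemeasurable]
    refine ne_top_of_le_ne_top (b := 4 * (a : ℝ≥0∞) * 2) (by finiteness) ?_
    have hg : 4 * (a : ℝ≥0∞) * 2 = ∑' n : ℕ, 4 * (a : ℝ≥0∞) * 2⁻¹ ^ n := by
      rw [ENNReal.tsum_mul_left, ENNReal.tsum_geometric_two]
    rw [hg]
    refine ENNReal.tsum_le_tsum fun n => ?_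
    rw [lintegral_const_mul _ (measurable_chainWeight_pi _ _ _)]
    calc _ ≤ 2 ^ (n + 1) * (4 * (a : ℝ≥0∞) * 4⁻¹ ^ (n + 1)) := by
          gcongr
          exact (lintegral_chainWeight_le hhalf a n).trans (by gcongr)
      _ = 4 * a * (2 * 4⁻¹) ^ (n + 1) := by rw [mul_pow]; ring
      _ = 4 * a * 2⁻¹ ^ (n + 1) := by
          congr 2
          rw [show (4 : ℝ≥0∞) = 2 * 2 by norm_num, ENNReal.mul_inv (by simp) (by simp),
            ← mul_assoc, ENNReal.mul_inv_cancel (by simp) (by simp), one_mul]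
      _ ≤ 4 * a * 2⁻¹ ^ n := by
          exact mul_le_mul' le_rfl
            (pow_le_pow_right_of_le_one' (ENNReal.inv_le_one.2 one_le_two) n.le_succ)
  have hae := ae_lt_top (Measurable.tsum fun n =>
    (measurable_chainWeight_pi (m : ℝ) a (n + 1)).const_mul (2 ^ (n + 1))) hfin
  filter_upwards [hae, ae_regular] with ω hω hreg
  have ht := ENNReal.tendsto_atTop_zero_of_tsum_ne_top hω.ne
  have hev := (tendsto_add_atTop_iff_nat (f := fun n : ℕ => (2 : ℝ≥0∞) ^ n *
    chainWeight m a ω n) 1).1 ht |>.eventually (gt_mem_nhds one_pos)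
  filter_upwards [hev] with n hn
  by_contra! hlt
  have h0 : 0 ≤ Real.log 2 / m * n :=
    mul_nonneg (div_pos (Real.log_pos one_lt_two) hm0).le n.cast_nonneg
  have h1 := hreg.exp_le_chainWeight hm0.le n h0 hlt.le
  have h2 : -(m : ℝ) * (Real.log 2 / m * n) = -(n * Real.log 2) := by
    field_simp
  rw [h2, Real.exp_neg, Real.exp_nat_mul, Real.exp_log two_pos] at h1
  have h3 : (2 : ℝ≥0∞) ^ n * ENNReal.ofReal (2 ^ n)⁻¹ = 1 := by
    rw [ENNReal.ofReal_inv_of_pos (by positivity), ENNReal.ofReal_pow two_pos.le]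
    simp only [ENNReal.ofReal_ofNat]
    exact ENNReal.mul_inv_cancel (by simp) (by finiteness)
  exact absurd (h3.symm.le.trans (mul_le_mul' le_rfl h1)) (not_le.2 hn)

theorem velocity_lt_top (a : ℕ) : velocity a < ⊤ := by
  obtain ⟨c, hc, h⟩ := exists_frontTime_ge a
  -- The extra `1` covers the finitely many `n ≤ n₀` without a time bound, once `t ≥ n₀`.
  refine lt_of_le_of_lt (essSup_le_of_ae_le (ENNReal.ofReal (c⁻¹ + 1)) ?_) ENNReal.ofReal_lt_top
  filter_upwards [h] with ω hω
  obtain ⟨n₀, hn₀⟩ := eventually_atTop.1 hω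
  refine limsup_le_of_le (by isBoundedDefault) ?_
  filter_upwards [eventually_ge_atTop (n₀ : ℝ≥0), eventually_gt_atTop 0] with t ht ht0
  have hfr : (front a (fun _ => a) ω t : ℝ≥0∞) ≤ ENNReal.ofReal ((c⁻¹ + 1) * t) := by
    have hf : front a (fun _ => a) ω t ≤ (⌊(c⁻¹ + 1) * (t : ℝ)⌋₊ : ℕ∞) := by
      refine iSup₂_le fun n hn => ?_
      have ht' : (0 : ℝ) < t := by exact_mod_cast ht0
      have hci : 0 < c⁻¹ := inv_pos.2 hc
      refine Nat.cast_le.2 (Nat.le_floor ?_)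
      rcases le_total n n₀ with hle | hle
      · have h1 : (n : ℝ) ≤ t := by
          have : (n : ℝ) ≤ n₀ := by exact_mod_cast hle
          exact this.trans (by exact_mod_cast ht)
        nlinarith
      · have h1 := (hn₀ n hle).trans hn
        rw [ENNReal.ofReal_le_coe] at h1
        have h2 : (n : ℝ) ≤ c⁻¹ * t := by
          rw [inv_mul_eq_div, le_div_iff₀ hc]
          linarith
        nlinarith
    calc (front a (fun _ => a) ω t : ℝ≥0∞)
        ≤ ((⌊(c⁻¹ + 1) * (t : ℝ)⌋₊ : ℕ∞) : ℝ≥0∞) := ENat.toENNReal_le.2 hf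
      _ = ENNReal.ofReal (⌊(c⁻¹ + 1) * (t : ℝ)⌋₊ : ℝ) := by simp
      _ ≤ _ := ENNReal.ofReal_le_ofReal (Nat.floor_le (by positivity))
  rw [frontRatio]
  refine ENNReal.div_le_of_le_mul (hfr.trans ?_)
  rw [ENNReal.ofReal_mul (by positivity), ENNReal.ofReal_coe_nnreal]

/-! ### Speeding up the front by remote particles -/

/-- The law of the holding times and increments of a single walk. -/
noncomputable def walkLaw : Measure (ℕ → ℝ × ℤ) :=
  Measure.infinitePi (fun _ : ℕ => (expMeasure 2).prod stepLaw)

instance : IsProbabilityMeasure walkLaw := by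
  unfold walkLaw
  infer_instance

/-- The first `n` jumps are completed by time `s` and lead to `D` or beyond. -/
def escapeSet (n : ℕ) (s : ℝ) (D : ℤ) : Set (ℕ → ℝ × ℤ) :=
  {c | ∑ k ∈ Finset.range n, (c k).1 ≤ s ∧ D ≤ ∑ k ∈ Finset.range n, (c k).2}

theorem measurableSet_escapeSet (n : ℕ) (s : ℝ) (D : ℤ) : MeasurableSet (escapeSet n s D) := by
  rw [escapeSet, Set.ofPred_and]
  refine (measurableSet_le ?_ measurable_const).inter (measurableSet_le measurable_const ?_)
  · exact Finset.measurable_fun_sum _ fun k _ => (measurable_pi_apply k).fst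
  · exact Finset.measurable_fun_sum _ fun k _ => (measurable_pi_apply k).snd

/-- Currying the sample exhibits the walks of different labels as independent copies of `walkLaw`.
-/
theorem law_forall_notMem (x : ℤ) (N : ℕ) {E : Set (ℕ → ℝ × ℤ)} (hE : MeasurableSet E) :
    law {ω | ∀ i < N, (fun k => ω ((x, i), k)) ∉ E} = walkLaw Eᶜ ^ N := by
  have hcurry : law.map (MeasurableEquiv.curry Label ℕ (ℝ × ℤ)) =
      Measure.infinitePi (fun _ : Label => walkLaw) :=
    Measure.infinitePi_map_curry (fun (_ : Label) (_ : ℕ) => (expMeasure 2).prod stepLaw)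
  classical
  have hset : {ω : Sample | ∀ i < N, (fun k => ω ((x, i), k)) ∉ E} =
      MeasurableEquiv.curry Label ℕ (ℝ × ℤ) ⁻¹'
        Set.pi ((Finset.range N).image fun i => ((x, i) : Label)) (fun _ => Eᶜ) := by
    ext ω
    simp only [Set.mem_ofPred_eq, Set.mem_preimage, Set.mem_pi, Finset.coe_image, Set.mem_image,
      Finset.mem_coe, Finset.mem_range, forall_exists_index, and_imp, forall_apply_eq_imp_iff₂]
    rfl
  rw [hset, ← MeasurableEquiv.map_apply, hcurry, Measure.infinitePi_pi _ fun _ _ => hE.compl,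
    Finset.prod_const, Finset.card_image_of_injective _ fun i j h => (Prod.ext_iff.1 h).2,
    Finset.card_range]

/-- The front reaches `D` by time `t` unless all particles starting from `-m` fail to do so. -/
theorem law_lt_frontTime_le {a : ℕ} {η : ℤ → ℕ} {m n D : ℕ} {t : ℝ≥0} {K : ℝ}
    (hK : K ≤ η (-m) * walkLaw.real (escapeSet n t (m + D))) :
    law {ω | (t : ℝ≥0∞) < frontTime a η ω D} ≤ ENNReal.ofReal (Real.exp (-K)) := by
  have hE := measurableSet_escapeSet n t (m + D)
  have hsub : {ω | (t : ℝ≥0∞) < frontTime a η ω D} ≤ᵐ[law]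
      {ω | ∀ i < η (-m), (fun k => ω ((-(m : ℤ), i), k)) ∉ escapeSet n t (m + D)} := by
    filter_upwards [ae_regular] with ω hω hlt i hi hmem
    refine absurd hlt (not_lt.2 ?_)
    refine (hω.frontTime_le_jumpTime (x := -(m : ℤ)) (by omega) hi D n ?_).trans ?_
    · have := hmem.2
      dsimp only at this
      omega
    · exact ENNReal.ofReal_le_coe.2 hmem.1
  refine (measure_mono_ae hsub).trans ?_
  rw [law_forall_notMem _ _ hE, ← ofReal_measureReal, probReal_compl_eq_one_sub hE,
    ← ENNReal.ofReal_pow (sub_nonneg.2 measureReal_le_one)]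
  refine ENNReal.ofReal_le_ofReal ?_
  calc (1 - walkLaw.real (escapeSet n t (m + D))) ^ η (-m)
      ≤ Real.exp (-walkLaw.real (escapeSet n t (m + D))) ^ η (-m) :=
        pow_le_pow_left₀ (sub_nonneg.2 measureReal_le_one) (Real.one_sub_le_exp_neg _) _
    _ = Real.exp (-(η (-m) * walkLaw.real (escapeSet n t (m + D)))) := by
        rw [← Real.exp_nat_mul, mul_neg]
    _ ≤ _ := Real.exp_le_exp.2 (neg_le_neg hK)

/-! ### Lower bounds for the escape probability of one walk -/

theorem lintegral_prod_walkLaw {f : ℝ × ℤ → ℝ≥0∞} (hf : Measurable f) (n : ℕ) :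
    ∫⁻ c, ∏ k ∈ Finset.range n, f (c k) ∂walkLaw =
      (∫⁻ z, f z ∂(expMeasure 2).prod stepLaw) ^ n := by
  have hind : iIndepFun (fun (k : ℕ) (c : ℕ → ℝ × ℤ) => f (c k)) walkLaw :=
    iIndepFun_infinitePi (P := fun _ : ℕ => (expMeasure 2).prod stepLaw) (X := fun _ => f)
      (fun _ => hf)
  rw [lintegral_prod_eq_prod_lintegral_of_indepFun _ _ hind
    fun k => hf.comp (measurable_pi_apply k), Finset.prod_congr rfl, Finset.prod_const,
    Finset.card_range]
  intro k _
  exact (measurePreserving_eval_infinitePi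
    (fun _ : ℕ => (expMeasure 2).prod stepLaw) k).lintegral_comp hf

/-- All of the first `n` jumps being fast and upwards. -/
theorem pow_le_measureReal_escapeSet {h : ℝ} (hh : 0 ≤ h) (n : ℕ) {D : ℤ} (hD : D ≤ n) :
    ((1 - Real.exp (-(2 * h))) / 2) ^ n ≤ walkLaw.real (escapeSet n (n * h) D) := by
  have hs : walkLaw.real (Set.pi (Finset.range n) fun _ => Set.Iic h ×ˢ {(1 : ℤ)}) =
      ((1 - Real.exp (-(2 * h))) / 2) ^ n := by
    rw [measureReal_def, walkLaw, Measure.infinitePi_pi _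
      fun _ _ => measurableSet_Iic.prod (measurableSet_singleton _), Finset.prod_const,
      Finset.card_range, Measure.prod_prod, ENNReal.toReal_pow, ENNReal.toReal_mul,
      stepLaw_singleton (Or.inr rfl), ← measureReal_def, measureReal_Iic_expMeasure hh]
    simp [div_eq_mul_inv]
  rw [← hs]
  refine measureReal_mono fun c hc => ?_
  have hc' : ∀ k ∈ Finset.range n, (c k).1 ≤ h ∧ (c k).2 = 1 := fun k hk => hc k hk
  refine ⟨(Finset.sum_le_sum fun k hk => (hc' k hk).1).trans (by simp), ?_⟩
  rw [Finset.sum_congr rfl fun k hk => (hc' k hk).2]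
  simpa using hD

/-- The Paley-Zygmund inequality, with a worse constant. -/
theorem paley_zygmund {Ω : Type*} [MeasurableSpace Ω] {μ : Measure Ω} [IsProbabilityMeasure μ]
    {Y : Ω → ℝ} (hY : Measurable Y) {A B : ℝ} (hA : 0 < A) (hB : 0 < B)
    (hAY : ENNReal.ofReal A ≤ ∫⁻ ω, ENNReal.ofReal (Y ω) ∂μ)
    (hBY : ∫⁻ ω, ENNReal.ofReal (Y ω ^ 2) ∂μ ≤ ENNReal.ofReal B) :
    A ^ 2 / (16 * B) ≤ μ.real {ω | A / 2 ≤ Y ω} := by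
  set E : Set Ω := {ω | A / 2 ≤ Y ω} with hE
  have hEm : MeasurableSet E := measurableSet_le measurable_const hY
  -- On `E`, `Y ≤ K + Y² / K`; off `E`, `Y ≤ A / 2`. This `K` makes the second moment term `A / 4`,
  -- leaving `A / 4 ≤ K * μ(E)`.
  set K : ℝ := 4 * B / A with hK
  have hKpos : 0 < K := by positivity
  have hpt : ∀ ω, ENNReal.ofReal (Y ω) ≤ ENNReal.ofReal (A / 2) +
      (E.indicator (fun _ => ENNReal.ofReal K) ω +
        ENNReal.ofReal K⁻¹ * ENNReal.ofReal (Y ω ^ 2)) := by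
    intro ω
    by_cases hω : ω ∈ E
    · rw [Set.indicator_of_mem hω]
      refine le_trans ?_ le_add_self
      rw [← ENNReal.ofReal_mul (by positivity), ← ENNReal.ofReal_add hKpos.le (by positivity)]
      refine ENNReal.ofReal_le_ofReal ?_
      have : Y ω ≤ (K ^ 2 + Y ω ^ 2) / K := by
        rw [le_div_iff₀ hKpos]
        nlinarith [sq_nonneg (K - Y ω), sq_nonneg (K + Y ω)]
      calc Y ω ≤ (K ^ 2 + Y ω ^ 2) / K := this
        _ = K + K⁻¹ * Y ω ^ 2 := by field_simp
    · refine le_trans ?_ le_self_add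
      exact ENNReal.ofReal_le_ofReal (not_le.1 hω).le
  have hint : ENNReal.ofReal A ≤ ENNReal.ofReal (A / 2 + (K * μ.real E + K⁻¹ * B)) := by
    calc ENNReal.ofReal A ≤ _ := hAY
      _ ≤ _ := lintegral_mono hpt
      _ = ENNReal.ofReal (A / 2) + (ENNReal.ofReal K * μ E +
          ENNReal.ofReal K⁻¹ * ∫⁻ ω, ENNReal.ofReal (Y ω ^ 2) ∂μ) := by
        rw [lintegral_add_left measurable_const,
          lintegral_add_left (measurable_const.indicator hEm),
          lintegral_const_mul _ (hY.pow_const 2).ennreal_ofReal, lintegral_indicator_const hEm]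
        simp
      _ ≤ ENNReal.ofReal (A / 2) + (ENNReal.ofReal K * ENNReal.ofReal (μ.real E) +
          ENNReal.ofReal K⁻¹ * ENNReal.ofReal B) := by
        rw [ofReal_measureReal]
        gcongr
      _ = _ := by
        rw [← ENNReal.ofReal_mul hKpos.le, ← ENNReal.ofReal_mul (by positivity),
          ← ENNReal.ofReal_add (by positivity) (by positivity),
          ← ENNReal.ofReal_add (by positivity) (by positivity)]
  rw [ENNReal.ofReal_le_ofReal_iff (by positivity)] at hint
  have h1 : K⁻¹ * B = A / 4 := by
    rw [hK]
    field_simp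
  have h2 : A ^ 2 / (16 * B) = A / 4 / K := by
    rw [hK]
    field_simp
    norm_num
  rw [h2, div_le_iff₀ hKpos]
  linarith

theorem exp_sq_div_four_le_cosh {x : ℝ} (h0 : 0 ≤ x) (h1 : x ≤ 1) :
    Real.exp (x ^ 2 / 4) ≤ Real.cosh x := by
  have hc : 1 + x ^ 2 / 2 ≤ Real.cosh x := by
    have h := Real.cosh_two_mul (x / 2)
    rw [Real.cosh_sq, mul_div_cancel₀ x two_ne_zero] at h
    have hs : x / 2 ≤ Real.sinh (x / 2) := Real.self_le_sinh_iff.2 (by linarith)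
    nlinarith
  have he : Real.exp (x ^ 2 / 4) ≤ 1 / (1 - x ^ 2 / 4) :=
    Real.exp_bound_div_one_sub_of_interval (by positivity) (by nlinarith)
  refine (he.trans ?_).trans hc
  rw [div_le_iff₀ (by nlinarith)]
  nlinarith [mul_nonneg (sq_nonneg x) (show 0 ≤ 1 - x ^ 2 by nlinarith)]

/-- The exponential of the increment of a jump, killed if the jump takes longer than `h`. -/
noncomputable def jumpWeight (lam h : ℝ) (z : ℝ × ℤ) : ℝ :=
  (Set.Iic h).indicator 1 z.1 * Real.exp (lam * z.2)

theorem measurable_jumpWeight (lam h : ℝ) : Measurable (jumpWeight lam h) := by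
  refine Measurable.mul ?_ (by fun_prop)
  exact (measurable_one.indicator measurableSet_Iic).comp measurable_fst

theorem jumpWeight_nonneg (lam h : ℝ) (z : ℝ × ℤ) : 0 ≤ jumpWeight lam h z :=
  mul_nonneg (Set.indicator_nonneg (fun _ _ => zero_le_one) _) (Real.exp_pos _).le

/-- Second moments thereby become first moments at twice the parameter. -/
theorem jumpWeight_sq (lam h : ℝ) (z : ℝ × ℤ) :
    jumpWeight lam h z ^ 2 = jumpWeight (2 * lam) h z := by
  unfold jumpWeight
  rw [mul_pow, ← Real.exp_nat_mul]
  congr 1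
  · by_cases hz : z.1 ∈ Set.Iic h <;> simp [hz]
  · push_cast
    ring_nf

theorem lintegral_jumpWeight (lam : ℝ) {h : ℝ} (hh : 0 ≤ h) :
    ∫⁻ z, ENNReal.ofReal (jumpWeight lam h z) ∂(expMeasure 2).prod stepLaw =
      ENNReal.ofReal ((1 - Real.exp (-(2 * h))) * Real.cosh lam) := by
  have hi : ∀ x : ℝ, ENNReal.ofReal ((Set.Iic h).indicator (1 : ℝ → ℝ) x) =
      (Set.Iic h).indicator (1 : ℝ → ℝ≥0∞) x := by
    intro x
    by_cases hx : x ∈ Set.Iic h <;> simp [hx]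
  simp only [jumpWeight]
  simp_rw [ENNReal.ofReal_mul' (Real.exp_pos _).le, hi]
  rw [lintegral_prod_mul (f := (Set.Iic h).indicator (1 : ℝ → ℝ≥0∞))
    (g := fun s : ℤ => ENNReal.ofReal (Real.exp (lam * s)))
    (measurable_one.indicator measurableSet_Iic).aemeasurable (by fun_prop),
    lintegral_indicator_one measurableSet_Iic, lintegral_exp_mul_stepLaw,
    ENNReal.ofReal_mul' (Real.cosh_pos _).le, ← measureReal_Iic_expMeasure hh, ofReal_measureReal]

/-- A large deviation lower bound for the walk. -/
theorem exp_le_measureReal_escapeSet {lam h : ℝ} (hlam : 0 < lam) (hlam1 : lam ≤ 1) (hh : 0 ≤ h)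
    (hq : Real.exp (-(lam ^ 2 / 8)) ≤ 1 - Real.exp (-(2 * h))) {n : ℕ} (hn : 16 ≤ lam ^ 2 * n)
    {D : ℤ} (hD : (D : ℝ) < lam * n / 16 + 1) :
    Real.exp (-(2 * lam ^ 2 * n)) / 16 ≤ walkLaw.real (escapeSet n (n * h) D) := by
  set Y : (ℕ → ℝ × ℤ) → ℝ := fun c => ∏ k ∈ Finset.range n, jumpWeight lam h (c k) with hYdef
  have hYm : Measurable Y := Finset.measurable_fun_prod _ fun k _ =>
    (measurable_jumpWeight lam h).comp (measurable_pi_apply k)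
  have hq1 : 1 - Real.exp (-(2 * h)) ≤ 1 := by linarith [Real.exp_pos (-(2 * h))]
  have hq0 : 0 ≤ 1 - Real.exp (-(2 * h)) := (Real.exp_pos _).le.trans hq
  have hYint : ∀ l : ℝ, ∫⁻ c, ENNReal.ofReal (∏ k ∈ Finset.range n, jumpWeight l h (c k)) ∂walkLaw =
      ENNReal.ofReal (((1 - Real.exp (-(2 * h))) * Real.cosh l) ^ n) := by
    intro l
    simp_rw [ENNReal.ofReal_prod_of_nonneg fun k _ => jumpWeight_nonneg l h _]
    rw [lintegral_prod_walkLaw (measurable_jumpWeight l h).ennreal_ofReal,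
      lintegral_jumpWeight l hh, ENNReal.ofReal_pow (mul_nonneg hq0 (Real.cosh_pos _).le)]
  -- Per jump, `cosh lam` gains `exp (lam² / 4)` and killing slow jumps loses at most `exp (-lam² /
  -- 8)`.
  have hA : ENNReal.ofReal (Real.exp (lam ^ 2 * n / 8)) ≤ ∫⁻ c, ENNReal.ofReal (Y c) ∂walkLaw := by
    rw [hYint]
    refine ENNReal.ofReal_le_ofReal ?_
    calc Real.exp (lam ^ 2 * n / 8)
        = (Real.exp (-(lam ^ 2 / 8)) * Real.exp (lam ^ 2 / 4)) ^ n := by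
          rw [← Real.exp_add, ← Real.exp_nat_mul]
          ring_nf
      _ ≤ _ := by
          gcongr
          exact exp_sq_div_four_le_cosh hlam.le hlam1
  have hB : ∫⁻ c, ENNReal.ofReal (Y c ^ 2) ∂walkLaw ≤
      ENNReal.ofReal (Real.exp (2 * lam ^ 2 * n)) := by
    simp_rw [hYdef, ← Finset.prod_pow, jumpWeight_sq]
    rw [hYint]
    refine ENNReal.ofReal_le_ofReal ?_
    have hc : (1 - Real.exp (-(2 * h))) * Real.cosh (2 * lam) ≤ Real.exp (2 * lam ^ 2) := by
      refine (mul_le_of_le_one_left (Real.cosh_pos _).le hq1).trans ?_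
      refine (Real.cosh_le_exp_half_sq _).trans (Real.exp_le_exp.2 ?_)
      nlinarith
    calc _ ≤ Real.exp (2 * lam ^ 2) ^ n :=
          pow_le_pow_left₀ (mul_nonneg hq0 (Real.cosh_pos _).le) hc n
      _ = _ := by
          rw [← Real.exp_nat_mul]
          ring_nf
  have hpz := paley_zygmund hYm (Real.exp_pos _) (Real.exp_pos _) hA hB
  calc Real.exp (-(2 * lam ^ 2 * n)) / 16
      ≤ Real.exp (lam ^ 2 * n / 8) ^ 2 / (16 * Real.exp (2 * lam ^ 2 * n)) := by
        rw [Real.exp_neg, div_le_div_iff₀ (by norm_num) (by positivity)]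
        have h1 : 1 ≤ Real.exp (lam ^ 2 * n / 8) ^ 2 :=
          one_le_pow₀ (Real.one_le_exp (by positivity))
        rw [mul_left_comm, inv_mul_cancel₀ (Real.exp_pos _).ne']
        linarith
    _ ≤ _ := hpz
    _ ≤ _ := by
        refine measureReal_mono fun c hc => ?_
        change Real.exp (lam ^ 2 * n / 8) / 2 ≤ Y c at hc
        have hpos : 0 < Y c := (by positivity : 0 < Real.exp (lam ^ 2 * n / 8) / 2).trans_le hc
        have hfast : ∀ k ∈ Finset.range n, (c k).1 ≤ h := by
          intro k hk
          by_contra hlt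
          refine hpos.ne' (Finset.prod_eq_zero hk ?_)
          rw [jumpWeight, Set.indicator_of_notMem (by simpa using hlt), zero_mul]
        refine ⟨(Finset.sum_le_sum hfast).trans (by simp), ?_⟩
        have hYexp : Y c = Real.exp (lam * (∑ k ∈ Finset.range n, (c k).2 : ℤ)) := by
          rw [hYdef]
          push_cast
          rw [Finset.mul_sum, Real.exp_sum]
          refine Finset.prod_congr rfl fun k hk => ?_
          rw [jumpWeight, Set.indicator_of_mem (Set.mem_Iic.2 (hfast k hk)), Pi.one_apply, one_mul]
        set S : ℤ := ∑ k ∈ Finset.range n, (c k).2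
        -- The factor `1/2` costs at most `1` in the exponent because `2 ≤ e`; `hn` then absorbs
        -- this `1` into half of `lam² n / 8`.
        have h2 : Real.exp (lam ^ 2 * n / 8 - 1) ≤ Real.exp (lam * S) := by
          rw [← hYexp]
          refine le_trans ?_ hc
          rw [Real.exp_sub]
          have := Real.add_one_le_exp 1
          gcongr
          linarith
        have h3 := Real.exp_le_exp.1 h2
        have h4 : lam * (lam * n / 16) ≤ lam * S := by nlinarith
        have h5 := le_of_mul_le_mul_left h4 hlam
        have h6 : (D : ℝ) < S + 1 := by linarith
        have h7 : D < S + 1 := by exact_mod_cast h6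
        omega

/-! ### Exponentially many particles against exponentially small escape probabilities -/

theorem exists_exp_le_of_liminf {η : ℤ → ℕ} {θ : ℝ}
    (h : liminf (fun x : ℤ => (((η x : ℝ) * Real.exp (θ * (x : ℝ)) : ℝ) : EReal)) atBot = ⊤) :
    ∃ m₀ : ℕ, ∀ m : ℕ, m₀ ≤ m → Real.exp (θ * m) ≤ η (-m) := by
  have h1 : ((1 : ℝ) : EReal) <
      liminf (fun x : ℤ => (((η x : ℝ) * Real.exp (θ * (x : ℝ)) : ℝ) : EReal)) atBot := by
    rw [h]
    exact EReal.coe_lt_top 1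
  obtain ⟨x₀, hx₀⟩ := eventually_atBot.1 (eventually_lt_of_lt_liminf h1)
  refine ⟨x₀.natAbs, fun m hm => ?_⟩
  have h2 := (EReal.coe_lt_coe_iff.1 (hx₀ (-m) (by omega))).le
  push_cast at h2
  rw [mul_neg, Real.exp_neg, ← div_eq_mul_inv, one_le_div (Real.exp_pos _)] at h2
  exact h2

theorem exists_law_frontRatio_le {a : ℕ} {η : ℤ → ℕ} {θ : ℝ} (hθ : 0 < θ) {m₀ : ℕ}
    (hη : ∀ m : ℕ, m₀ ≤ m → Real.exp (θ * m) ≤ η (-m)) :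
    ∃ b : ℝ≥0, 0 < b ∧ ∀ᶠ t : ℝ≥0 in atTop,
      law {ω | frontRatio a η ω t ≤ (b : ℝ≥0∞)} ≤ ENNReal.ofReal (Real.exp (-t)) := by
  -- At distance about `lam * n / 32` there are then about `exp (4 lam² n)` particles or more,
  -- against an escape cost of `exp (-2 lam² n)`.
  obtain ⟨lam, hlam, hlam1, hlamθ⟩ : ∃ lam : ℝ, 0 < lam ∧ lam ≤ 1 ∧ 128 * lam ≤ θ :=
    ⟨min 1 (θ / 128), lt_min one_pos (by positivity), min_le_left _ _, by
      have := min_le_right 1 (θ / 128)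
      linarith⟩
  obtain ⟨h, hq, hh⟩ : ∃ h : ℝ, Real.exp (-(lam ^ 2 / 8)) ≤ 1 - Real.exp (-(2 * h)) ∧ 0 < h := by
    have ht : Tendsto (fun h : ℝ => 1 - Real.exp (-(2 * h))) atTop (𝓝 (1 - 0)) := by
      refine tendsto_const_nhds.sub (Real.tendsto_exp_atBot.comp ?_)
      exact tendsto_neg_atTop_atBot.comp (tendsto_id.const_mul_atTop two_pos)
    rw [sub_zero] at ht
    have hlt : Real.exp (-(lam ^ 2 / 8)) < 1 := Real.exp_lt_one_iff.2 (by nlinarith)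
    exact ((ht.eventually (Ici_mem_nhds hlt)).and (eventually_gt_atTop 0)).exists
  -- Half of the `lam * t / (64 * h)` that `D` exceeds for large `t`, where `n > t / (2 * h)`; the
  -- slack gives a strict contradiction.
  refine ⟨(lam / (128 * h)).toNNReal, Real.toNNReal_pos.2 (by positivity), ?_⟩
  have hfl : Tendsto (fun t : ℝ => ⌊t / h⌋₊) atTop atTop :=
    tendsto_nat_floor_atTop.comp (tendsto_id.atTop_div_const hh)
  have hev : ∀ᶠ t : ℝ in atTop, 2 * h ≤ t ∧ 0 < t ∧ 16 ≤ lam ^ 2 * ⌊t / h⌋₊ ∧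
      m₀ ≤ ⌊lam * ⌊t / h⌋₊ / 32⌋₊ ∧
      -- The factor `exp (-θ - 2 * lam ^ 2)` pays for the two floors defining `m` and `n`.
      t ≤ Real.exp (-θ - 2 * lam ^ 2) / 16 * Real.exp (2 * lam ^ 2 / h * t) := by
    have hc : Tendsto (fun t : ℝ => ((⌊t / h⌋₊ : ℕ) : ℝ)) atTop atTop :=
      tendsto_natCast_atTop_atTop.comp hfl
    refine (eventually_ge_atTop _).and ((eventually_gt_atTop 0).and
      (((hc.const_mul_atTop (pow_pos hlam 2)).eventually_ge_atTop 16).and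
      (((tendsto_nat_floor_atTop.comp ((hc.const_mul_atTop hlam).atTop_div_const
        (by norm_num : (0 : ℝ) < 32))).eventually_ge_atTop m₀).and ?_)))
    have ho := (isLittleO_pow_exp_pos_mul_atTop 1 (b := 2 * lam ^ 2 / h) (by positivity)).bound
      (c := Real.exp (-θ - 2 * lam ^ 2) / 16) (by positivity)
    filter_upwards [ho] with t ht
    rw [pow_one, Real.norm_of_nonneg (Real.exp_pos _).le] at ht
    exact (Real.le_norm_self t).trans ht
  have hev' := (NNReal.tendsto_coe_atTop.2 (tendsto_id (α := ℝ≥0) (x := atTop))).eventually hev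
  filter_upwards [hev'] with t ⟨ht1, ht2, hn16, hm, ht3⟩
  simp only [id] at ht1 ht2 hn16 hm ht3
  set n : ℕ := ⌊(t : ℝ) / h⌋₊ with hn
  set m : ℕ := ⌊lam * n / 32⌋₊ with hmdef
  set D : ℕ := ⌈lam * n / 32⌉₊ with hD
  have hx0 : 0 ≤ lam * n / 32 := by positivity
  have hnt : (n : ℝ) * h ≤ t := by
    rw [← le_div_iff₀ hh]
    exact Nat.floor_le (by positivity)
  have htn : (t : ℝ) / h < n + 1 := Nat.lt_floor_add_one _
  have hm1 : (m : ℝ) ≤ lam * n / 32 := Nat.floor_le hx0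
  have hm2 : lam * n / 32 < m + 1 := Nat.lt_floor_add_one _
  have hD1 : lam * n / 32 ≤ D := Nat.le_ceil _
  have hD2 : (D : ℝ) < lam * n / 32 + 1 := Nat.ceil_lt_add_one hx0
  have hesc : Real.exp (-(2 * lam ^ 2 * n)) / 16 ≤ walkLaw.real (escapeSet n t (m + D)) := by
    refine (exp_le_measureReal_escapeSet hlam hlam1 hh.le hq hn16 (D := (m + D : ℤ)) ?_).trans
      (measureReal_mono fun c hc => ⟨hc.1.trans hnt, hc.2⟩)
    push_cast
    linarith
  have hK : (t : ℝ) ≤ η (-m) * walkLaw.real (escapeSet n t (m + D)) := by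
    calc (t : ℝ) ≤ Real.exp (-θ - 2 * lam ^ 2) / 16 * Real.exp (2 * lam ^ 2 / h * t) := ht3
      _ = Real.exp (-θ - 2 * lam ^ 2 + 2 * lam ^ 2 * (t / h)) / 16 := by
          rw [Real.exp_add]
          ring_nf
      _ ≤ Real.exp (θ * m + -(2 * lam ^ 2 * n)) / 16 := by
          refine div_le_div_of_nonneg_right (Real.exp_le_exp.2 ?_) (by norm_num)
          have h1 : 2 * lam ^ 2 * (t / h) ≤ 2 * lam ^ 2 * (n + 1) := by gcongr
          have h2 : θ * (lam * n / 32) ≤ θ * (m + 1) := by gcongr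
          have h3 : 128 * lam * (lam * n / 32) ≤ θ * (lam * n / 32) := by gcongr
          nlinarith
      _ = Real.exp (θ * m) * (Real.exp (-(2 * lam ^ 2 * n)) / 16) := by
          rw [Real.exp_add]
          ring
      _ ≤ _ := mul_le_mul (hη m hm) hesc (by positivity) (Nat.cast_nonneg _)
  refine (measure_mono fun ω hω => ?_).trans (law_lt_frontTime_le (a := a) hK)
  by_contra hle
  have hfr : ((D : ℕ∞) : ℝ≥0∞) ≤ front a η ω t := ENat.toENNReal_le.2 (le_front (not_lt.1 hle))
  change front a η ω t / (t : ℝ≥0∞) ≤ _ at hω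
  have ht0 : (t : ℝ≥0∞) ≠ 0 := by
    have : t ≠ 0 := by
      rintro rfl
      exact lt_irrefl _ ht2
    exact_mod_cast this
  rw [ENNReal.div_le_iff ht0 ENNReal.coe_ne_top] at hω
  have hDt := hfr.trans hω
  have hDt' : D ≤ lam / (128 * h) * t := by
    rw [ENat.toENNReal_coe, ← ENNReal.coe_mul, ← ENNReal.coe_natCast, ENNReal.coe_le_coe,
      ← NNReal.coe_le_coe] at hDt
    simpa [Real.coe_toNNReal _ (by positivity : 0 ≤ lam / (128 * h))] using hDt
  have h1 : 2 ≤ (t : ℝ) / h := (le_div_iff₀ hh).2 ht1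
  have h2 : lam / (128 * h) * t = lam * (t / h) / 128 := by
    field_simp
  have h3 : lam * (t / h) ≤ lam * (2 * n) := by
    gcongr
    linarith
  have h4 : 0 < lam * (t / h) := by positivity
  linarith

/-- With `θ` chosen after `V`, the particles at distance `k` outnumber the inverse probability of an
all-fast, all-upward path by a factor `exp k`. The failure probabilities are therefore summable over
integer times `k`. -/
theorem exists_ae_le_liminf_frontRatio (a V : ℕ) :
    ∃ θ : ℝ, 0 < θ ∧ ∀ η : ℤ → ℕ,
      (∃ m₀ : ℕ, ∀ m : ℕ, m₀ ≤ m → Real.exp (θ * m) ≤ η (-m)) →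
      ∀ᵐ ω ∂law, (V : ℝ≥0∞) ≤ liminf (fun t : ℝ≥0 => frontRatio a η ω t) atTop := by
  set h : ℝ := (2 * (V : ℝ) + 1)⁻¹ with hh
  have hh0 : 0 < h := by positivity
  set q : ℝ := (1 - Real.exp (-(2 * h))) / 2 with hq
  have he : Real.exp (-(2 * h)) < 1 := Real.exp_lt_one_iff.2 (by linarith)
  have hq0 : 0 < q := by
    rw [hq]
    linarith
  have hq1 : q ≤ 1 := by
    have := Real.exp_pos (-(2 * h))
    rw [hq]
    linarith
  have hlog : Real.log q ≤ 0 := Real.log_nonpos hq0.le hq1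
  set L : ℝ := (2 * (V : ℝ) + 1) * Real.log q with hL
  have hL0 : L ≤ 0 := mul_nonpos_of_nonneg_of_nonpos (by positivity) hlog
  refine ⟨1 - L, by linarith, fun η ⟨m₀, hη⟩ => ?_⟩
  -- The target at time `k` is `V * (k + 1)`, not `V * k`, so that it serves all `t` in `[k, k +
  -- 1)`. The shift by `m₀ + 1` ensures both `k ≥ m₀` and `k ≥ 1`.
  have hbad : ∀ n : ℕ, law {ω | ((n + (m₀ + 1) : ℕ) : ℝ≥0∞) <
      frontTime a η ω (V * (n + (m₀ + 1) + 1))} ≤ ENNReal.ofReal (Real.exp (-n)) := by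
    intro n
    set k : ℕ := n + (m₀ + 1) with hk
    have hesc : q ^ (k * (2 * V + 1)) ≤
        walkLaw.real (escapeSet (k * (2 * V + 1)) (k : ℝ≥0) (k + (V * (k + 1) : ℕ))) := by
      refine (pow_le_measureReal_escapeSet hh0.le _ ?_).trans
        (measureReal_mono fun c hc => ⟨hc.1.trans ?_, hc.2⟩)
      · have : k + V * (k + 1) ≤ k * (2 * V + 1) := by
          have : V ≤ V * k := Nat.le_mul_of_pos_right V (by omega)
          nlinarith
        exact_mod_cast this
      · push_cast
        rw [hh, mul_assoc, mul_inv_cancel₀ (by positivity), mul_one]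
    have hK : (n : ℝ) ≤ η (-k) *
        walkLaw.real (escapeSet (k * (2 * V + 1)) (k : ℝ≥0) (k + (V * (k + 1) : ℕ))) := by
      calc (n : ℝ) ≤ k := by exact_mod_cast Nat.le_add_right _ _
        _ ≤ Real.exp k := by linarith [Real.add_one_le_exp (k : ℝ)]
        _ = Real.exp ((1 - L) * k) * q ^ (k * (2 * V + 1)) := by
            conv_rhs => rw [← Real.exp_log hq0, ← Real.exp_nat_mul, ← Real.exp_add]
            congr 1
            rw [hL]
            push_cast
            ring
        _ ≤ _ := mul_le_mul (hη k (by omega)) hesc (by positivity) (Nat.cast_nonneg _)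
    have := law_lt_frontTime_le (a := a) (t := (k : ℝ≥0)) hK
    simpa only [ENNReal.coe_natCast] using this
  have hsum : ∑' n : ℕ, law {ω | ((n + (m₀ + 1) : ℕ) : ℝ≥0∞) <
      frontTime a η ω (V * (n + (m₀ + 1) + 1))} ≠ ⊤ :=
    ne_top_of_le_ne_top Real.summable_exp_neg_nat.tsum_ofReal_ne_top (ENNReal.tsum_le_tsum hbad)
  filter_upwards [ae_eventually_notMem hsum] with ω hω
  obtain ⟨n₁, hn₁⟩ := eventually_atTop.1 hω
  refine le_liminf_of_le (by isBoundedDefault) ?_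
  filter_upwards [eventually_ge_atTop ((n₁ + (m₀ + 1) : ℕ) : ℝ≥0), eventually_gt_atTop 0]
    with t ht ht0
  obtain ⟨n, hn⟩ : ∃ n, ⌊t⌋₊ = n + (m₀ + 1) := by
    have := Nat.le_floor ht
    exact ⟨⌊t⌋₊ - (m₀ + 1), by omega⟩
  have hn1 : n₁ ≤ n := by
    have := Nat.le_floor ht
    omega
  have hT := not_lt.1 (hn₁ n hn1)
  rw [← hn] at hT
  have hfl : ((⌊t⌋₊ : ℕ) : ℝ≥0∞) ≤ t := by
    exact_mod_cast Nat.floor_le t.2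
  have hfr := ENat.toENNReal_le.2 (le_front (hT.trans hfl))
  rw [frontRatio, ENNReal.le_div_iff_mul_le (Or.inl (by exact_mod_cast ht0.ne'))
    (Or.inl ENNReal.coe_ne_top)]
  refine le_trans ?_ hfr
  rw [ENat.toENNReal_coe, Nat.cast_mul]
  gcongr
  exact_mod_cast (Nat.lt_floor_add_one t).le

end FrontPropagation

theorem theorem3 (a : ℕ) (ha : 1 ≤ a) :
    (∀ η : ℤ → ℕ,
      (∃ θ : ℝ, 0 < θ ∧
        liminf (fun x : ℤ => (((η x : ℝ) * Real.exp (θ * (x : ℝ)) : ℝ) : EReal)) atBot = ⊤) →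
      ∃ b : ℝ≥0, 0 < b ∧
        limsup (fun t : ℝ≥0 => ((1 / (t : ℝ) : ℝ) : EReal) *
          ENNReal.log (law {ω | frontRatio a η ω t ≤ (b : ℝ≥0∞)})) atTop < 0) ∧
    (∃ (θ' : ℝ) (v' : ℝ≥0), 0 < θ' ∧ velocity a < (v' : ℝ≥0∞) ∧
      ∀ η : ℤ → ℕ,
        liminf (fun x : ℤ => (((η x : ℝ) * Real.exp (θ' * (x : ℝ)) : ℝ) : EReal)) atBot = ⊤ →
        ∀ᵐ ω ∂law, (v' : ℝ≥0∞) ≤ liminf (fun t : ℝ≥0 => frontRatio a η ω t) atTop) := by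
  constructor
  · rintro η ⟨θ, hθ, hη⟩
    obtain ⟨m₀, hm₀⟩ := exists_exp_le_of_liminf hη
    obtain ⟨b, hb, h⟩ := exists_law_frontRatio_le (a := a) hθ hm₀
    refine ⟨b, hb, lt_of_le_of_lt (b := ((-1 : ℝ) : EReal)) ?_ (by exact_mod_cast neg_one_lt_zero)⟩
    refine limsup_le_of_le (by isBoundedDefault) ?_
    filter_upwards [h, eventually_gt_atTop 0] with t ht ht0
    have ht0' : (0 : ℝ) < t := by exact_mod_cast ht0
    calc ((1 / (t : ℝ) : ℝ) : EReal) * ENNReal.log (law {ω | frontRatio a η ω t ≤ (b : ℝ≥0∞)})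
        ≤ ((1 / (t : ℝ) : ℝ) : EReal) * ((-t : ℝ) : EReal) := by
          refine mul_le_mul_of_nonneg_left ?_ (by exact_mod_cast (by positivity : 0 ≤ 1 / (t : ℝ)))
          refine (ENNReal.log_monotone ht).trans ?_
          rw [ENNReal.log_ofReal_of_pos (Real.exp_pos _), Real.log_exp]
      _ = ((-1 : ℝ) : EReal) := by
          rw [← EReal.coe_mul]
          congr 1
          field_simp
  -- `V` depends only on `a`, and `θ` only on `V` and `a`, so both are fixed before `η`.
  · obtain ⟨V, hV⟩ := ENNReal.exists_nat_gt (velocity_lt_top a).ne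
    obtain ⟨θ, hθ, h⟩ := exists_ae_le_liminf_frontRatio a V
    refine ⟨θ, V, hθ, by simpa using hV, fun η hη => ?_⟩
    simpa using h η (exists_exp_le_of_liminf hη)
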